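/- Let $(R,\mathfrak m,k)$ be a (commutative, noetherian) Cohen–Macaulay local ring of Krull dimension $1$ that has a canonical module $\omega$ (a maximal Cohen–Macaulay module of type one and of finite injective dimension; it is unique up to isomorphism). A Cohen–Macaulay local ring $R$ with canonical module $\omega$ is called almost Gorenstein (Goto–Takahashi–Taniguchi) if there is a short exact sequence $0\to R\to\omega\to C\to 0$ of $R$-modules such that $\mu(C)=\mathrm e(C)$, where $\mu(C)$ is the minimal number of generators of $C$ and $\mathrm e(C)$ is the multiplicity of $C$ with respect to the maximal ideal (with $\mathrm e(0)=0$). A Cohen–Macaulay local ring of Krull dimension at most $1$ with residue field $k$ is called weakly almost Gorenstein if it has a canonical module $\omega$ and an exact sequence $R\to\omega\to k^{\oplus n}\to 0$ for some $n\ge 0$ (the first map need not be injective). Then the following conditions are equivalent: 1. $R$ is almost Gorenstein. 2. $R$ is weakly almost Gorenstein. 3. $R/(x)$ is weakly almost Gorenstein for every $R$-regular element $x\in\mathfrak m$. 4. $R/(x)$ is weakly almost Gorenstein for some $R$-regular element $x\in\mathfrak m^2$. -/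

import Mathlib

universe u

open CategoryTheory

section

variable (R : Type u) [CommRing R] [IsLocalRing R]
variable (M : Type u) [AddCommGroup M] [Module R M]

/-- A finitely generated module `M` over a (noetherian) local ring `R` is maximal Cohen-Macaulay
if `depth M = dim R`, that is, if there is an `M`-regular sequence of length `dim R` in the maximal
ideal. (`IsRegular` includes `M ≠ (rs) M`, so that `M` is nonzero.) -/
structure IsMaximalCohenMacaulay : Prop where
  finite : Module.Finite R M
  exists_isRegular : ∃ rs : List R, (∀ r ∈ rs, r ∈ IsLocalRing.maximalIdeal R) ∧
    RingTheory.Sequence.IsRegular M rs ∧ (rs.length : WithBot ℕ∞) = ringKrullDim R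

/-- `R` is a Cohen-Macaulay local ring: a noetherian local ring with `depth R = dim R`. -/
structure IsCohenMacaulayLocalRing : Prop where
  noetherian : IsNoetherianRing R
  maximalCohenMacaulay : IsMaximalCohenMacaulay R R

/-- A maximal Cohen-Macaulay module `M` has type one: with `k` the residue field and
`d = dim R = depth M`, the `k`-vector space `Ext^d_R(k, M)` is one-dimensional. (It is killed by the
maximal ideal, so its dimension over `k` is its length over `R`.) -/
def HasTypeOne : Prop :=
  ∃ d : ℕ, ringKrullDim R = (d : WithBot ℕ∞) ∧
    Module.length R (Abelian.Ext (ModuleCat.of R (IsLocalRing.ResidueField R))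
      (ModuleCat.of R M) d) = 1

/-- A canonical module of a Cohen-Macaulay local ring `R`: a maximal Cohen-Macaulay module of type
one and of finite injective dimension. -/
structure IsCanonicalModule : Prop where
  maximalCohenMacaulay : IsMaximalCohenMacaulay R M
  typeOne : HasTypeOne R M
  finite_injectiveDimension : ∃ n : ℕ, HasInjectiveDimensionLE (ModuleCat.of R M) n

/-- `R` has a canonical module. -/
def HasCanonicalModule : Prop :=
  ∃ (ω : Type u) (_ : AddCommGroup ω) (_ : Module R ω), IsCanonicalModule R ω

/-- The (Krull) dimension of a finitely generated module over a noetherian local ring, as a natural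
number; the zero module gets the value `0`. -/
noncomputable def moduleDim : ℕ := ((Module.supportDim R M).unbotD 0).toNat

/-- `e` is the multiplicity of the finitely generated module `M` with respect to the maximal ideal
`𝔪`: with `d = dim M`, it is the limit of `d! * length (M / 𝔪 ^ (n + 1) M) / n ^ d`.
The zero module has multiplicity `0`. -/
def HasMultiplicity (e : ℝ) : Prop :=
  Filter.Tendsto
    (fun n : ℕ => ((moduleDim R M).factorial : ℝ) *
      ((Module.length R
        (M ⧸ (IsLocalRing.maximalIdeal R ^ (n + 1) • (⊤ : Submodule R M)))).toNat : ℝ) /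
      (n : ℝ) ^ moduleDim R M)
    Filter.atTop (nhds e)

/-- The minimal number of generators of a finitely generated module. -/
noncomputable def minGenerators : ℕ := (⊤ : Submodule R M).spanFinrank

end

/-- A Cohen-Macaulay local ring `R` with canonical module `ω` is almost Gorenstein (in the sense of
Goto, Takahashi and Taniguchi) if there is an exact sequence `0 → R → ω → C → 0` such that the
minimal number of generators of `C` equals the multiplicity of `C`. -/
def IsAlmostGorenstein (R : Type u) [CommRing R] : Prop :=
  ∃ _ : IsLocalRing R, IsCohenMacaulayLocalRing R ∧
    ∃ (ω : Type u) (_ : AddCommGroup ω) (_ : Module R ω), IsCanonicalModule R ω ∧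
      ∃ (C : Type u) (_ : AddCommGroup C) (_ : Module R C) (f : R →ₗ[R] ω) (g : ω →ₗ[R] C),
        Function.Injective f ∧ Function.Exact f g ∧ Function.Surjective g ∧
          HasMultiplicity R C (minGenerators R C)

/-- A Cohen-Macaulay local ring `R` of Krull dimension at most one with residue field `k` is weakly
almost Gorenstein if it has a canonical module `ω` and an exact sequence `R → ω → k ^ n → 0` for
some `n ≥ 0`; the first map need not be injective. -/
def IsWeaklyAlmostGorenstein (R : Type u) [CommRing R] : Prop :=
  ∃ _ : IsLocalRing R, IsCohenMacaulayLocalRing R ∧ ringKrullDim R ≤ 1 ∧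
    ∃ (ω : Type u) (_ : AddCommGroup ω) (_ : Module R ω), IsCanonicalModule R ω ∧
      ∃ (n : ℕ) (f : R →ₗ[R] ω) (g : ω →ₗ[R] (Fin n → IsLocalRing.ResidueField R)),
        Function.Exact f g ∧ Function.Surjective g

/-! ### Vanishing of Ext on modules of finite length. -/

section ExtVanishing

open Abelian

variable {R : Type u} [CommRing R]

/-! Everything passes through a reformulation of condition 2: some canonical module `ω` has an
element `w` with `𝔪ω ⊆ Rw`.

For 2 ⇒ 3 the inclusion descends to `ω/xω`, which is canonical over `R/(x)`
(`IsCanonicalModule.quotSMulTop`). Indeed `Hom(N, ω/xω) ≃ Ext^1(N, ω)` when `x` kills `N`, while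
finite injective dimension forces `Ext^2(N, ω) = 0` for `N` of finite length; the first turns type
one into a one-dimensional socle, and both together give Baer's criterion. For 3 ⇒ 4, square a
regular element.

For 4 ⇒ 2, canonical modules of the artinian ring `R/(x)` are isomorphic, so the given inclusion
lives in `ω/xω` and lifts to `𝔪ω ⊆ Rw + xω`. As `x ∈ 𝔪^2`, the error lies in `𝔪(𝔪ω)`, and Nakayama
removes it.

For 1 ⇒ 2, the bound `length (ω/xω) ≤ length (R/(x))` makes the cokernel `C` of `R → ω` of finite
length (`exists_pow_smul_eq_zero_of_length_le`). Then `e(C) = length C` and `μ(C) = length (C/𝔪C)`,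
so equality means `𝔪C = 0`. For 2 ⇒ 1, faithfulness of `ω` makes `r ↦ rw` injective, and its
cokernel is killed by `𝔪`. -/

theorem moduleCat_shortExact_of_submodule {N : Type u} [AddCommGroup N] [Module R N]
    (P : Submodule R N) :
    (ModuleCat.shortComplexOfCompEqZero P.subtype P.mkQ
      (LinearMap.exact_subtype_mkQ P).linearMap_comp_eq_zero).ShortExact :=
  ModuleCat.shortComplex_shortExact _ (LinearMap.exact_subtype_mkQ P) P.injective_subtype
    P.mkQ_surjective

/-- If every simple module embeds in a module `Q` of finite length with `Ext^i(Q, M) = 0` for all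
`i ≥ j`, and `M` has finite injective dimension, then `Ext^i(N, M) = 0` for all `i ≥ j` and all
modules `N` of finite length. -/
theorem ext_subsingleton_of_isFiniteLength (M : ModuleCat.{u} R) (n : ℕ)
    [HasInjectiveDimensionLT M n] (Q : Type u) [AddCommGroup Q] [Module R Q]
    (hQ : IsFiniteLength R Q)
    (hS : ∀ (S : Type u) [AddCommGroup S] [Module R S], IsSimpleModule R S →
      ∃ f : S →ₗ[R] Q, Function.Injective f)
    (j : ℕ) (hj : ∀ i, j ≤ i → Subsingleton (Ext (ModuleCat.of R Q) M i))
    {i : ℕ} (hi : j ≤ i) (N : Type u) [AddCommGroup N] [Module R N] (hN : IsFiniteLength R N) :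
    Subsingleton (Ext (ModuleCat.of R N) M i) := by
  -- Descending induction on the degree: `d` bounds how far `i` lies below `n`, from where on all
  -- Ext vanish.
  suffices H : ∀ d i : ℕ, j ≤ i → n ≤ i + d → ∀ (N : Type u) [AddCommGroup N] [Module R N],
      IsFiniteLength R N → Subsingleton (Ext (ModuleCat.of R N) M i) from
    H n i hi (by lia) N hN
  intro d
  induction d with
  | zero =>
    intro i _ hn N _ _ _
    exact HasInjectiveDimensionLT.subsingleton M n i (by lia) _
  | succ d ih =>
    intro i hi hn N _ _ hN
    have hsimple : ∀ (S : Type u) [AddCommGroup S] [Module R S], IsSimpleModule R S →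
        Subsingleton (Ext (ModuleCat.of R S) M i) := by
      intro S _ _ hSs
      obtain ⟨f, hf⟩ := hS S hSs
      have hse := ModuleCat.shortComplex_shortExact
        (ModuleCat.shortComplexOfCompEqZero f (LinearMap.range f).mkQ
          f.exact_map_mkQ_range.linearMap_comp_eq_zero) f.exact_map_mkQ_range hf
        (Submodule.mkQ_surjective _)
      -- `Ext^i(S, M)` sits between `Ext^i(Q, M)` and `Ext^(i+1)(Q/S, M)`, and both are zero.
      have h1 := ih (i + 1) (by lia) (by lia) (Q ⧸ LinearMap.range f)
        (hQ.of_surjective (Submodule.mkQ_surjective _))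
      have h2 := hj i hi
      refine subsingleton_of_forall_eq 0 fun y => ?_
      obtain ⟨z, hz⟩ := Ext.contravariant_sequence_exact₁ hse M y (n₁ := i + 1) (by lia)
        (h1.elim _ _)
      rw [← hz, h2.elim z 0, Ext.comp_zero]
    induction hN with
    | of_subsingleton =>
      refine subsingleton_of_forall_eq 0 fun y => ?_
      rw [← Ext.mk₀_id_comp y, (ModuleCat.isZero_of_subsingleton (ModuleCat.of R _)).eq_of_src
        (𝟙 _) 0, Ext.mk₀_zero, Ext.zero_comp]
    | @of_simple_quotient N _ _ P hs _ ihP =>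
      have hse := moduleCat_shortExact_of_submodule P
      have h1 := hsimple (N ⧸ P) hs
      refine subsingleton_of_forall_eq 0 fun y => ?_
      obtain ⟨z, hz⟩ := Ext.contravariant_sequence_exact₂ hse M y (ihP.elim _ _)
      rw [← hz, h1.elim z 0, Ext.comp_zero]

/-- Multiplication by `x` gives a free resolution `0 → R → R → R/(x) → 0` of length one. -/
theorem ext_quotient_span_singleton_subsingleton (x : R) (hx : IsSMulRegular R x) (M : ModuleCat.{u} R)
    {i : ℕ} (hi : 2 ≤ i) : Subsingleton (Ext (ModuleCat.of R (R ⧸ Ideal.span {x})) M i) := by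
  have h : Function.Exact (LinearMap.lsmul R R x) (Ideal.span {x}).mkQ := by
    intro y
    rw [← LinearMap.mem_ker, Submodule.ker_mkQ, Ideal.mem_span_singleton']
    simp [mul_comm]
  have hse := ModuleCat.shortComplex_shortExact
    (ModuleCat.shortComplexOfCompEqZero _ _ h.linearMap_comp_eq_zero) h hx
      (Submodule.mkQ_surjective _)
  obtain ⟨i, rfl⟩ : ∃ k, i = k + 2 := ⟨i - 2, by lia⟩
  have : Projective (ModuleCat.of R R) := ModuleCat.projective_of_free (Module.Basis.singleton Unit R)
  refine subsingleton_of_forall_eq 0 fun y => ?_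
  obtain ⟨z, hz⟩ := Ext.contravariant_sequence_exact₃ hse M y (Ext.eq_zero_of_projective _)
    (n₀ := i + 1) (by lia)
  rw [← hz, Ext.eq_zero_of_projective z, Ext.comp_zero]

end ExtVanishing

/-! ### Reduction modulo a regular element: Hom into `M/xM` versus `Ext^1` into `M`. -/

section RegularQuotient

open scoped Pointwise

open Abelian

variable {R : Type u} [CommRing R] {M : Type u} [AddCommGroup M] [Module R M] {x : R}

/-- The class in `Ext^1(M / x M, M)` of the extension `0 → M → M → M / x M → 0`. -/
noncomputable def quotSMulTopExtClass (hx : IsSMulRegular M x) :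
    Ext (ModuleCat.of R (QuotSMulTop x M)) (ModuleCat.of R M) 1 :=
  (IsSMulRegular.smulShortComplex_shortExact (M := ModuleCat.of R M) hx).extClass

theorem exists_hom_comp_quotSMulTopExtClass (hx : IsSMulRegular M x) {X : ModuleCat.{u} R}
    (β : Ext X (ModuleCat.of R M) 1) (hβ : x • β = 0) :
    ∃ g : X ⟶ ModuleCat.of R (QuotSMulTop x M),
      (Ext.mk₀ g).comp (quotSMulTopExtClass hx) (zero_add 1) = β := by
  rw [Ext.smul_eq_comp_mk₀] at hβ
  obtain ⟨γ, hγ⟩ := Ext.covariant_sequence_exact₁ X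
    (IsSMulRegular.smulShortComplex_shortExact (M := ModuleCat.of R M) hx)
    (n₀ := 0) β hβ (zero_add 1)
  obtain ⟨g, rfl⟩ := (Ext.mk₀_bijective _ _).2 γ
  exact ⟨g, hγ⟩

theorem exists_hom_eq_of_comp_quotSMulTopExtClass (hx : IsSMulRegular M x) {X : ModuleCat.{u} R}
    (g : X ⟶ ModuleCat.of R (QuotSMulTop x M))
    (hg : (Ext.mk₀ g).comp (quotSMulTopExtClass hx) (zero_add 1) = 0) :
    ∃ h : X ⟶ ModuleCat.of R M, h ≫ ModuleCat.ofHom (x • (⊤ : Submodule R M)).mkQ = g := by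
  obtain ⟨γ, hγ⟩ := Ext.covariant_sequence_exact₃ X
    (IsSMulRegular.smulShortComplex_shortExact (M := ModuleCat.of R M) hx)
    (Ext.mk₀ g) (zero_add 1) hg
  obtain ⟨h, rfl⟩ := (Ext.mk₀_bijective _ _).2 γ
  refine ⟨h, (Ext.mk₀_bijective _ _).1 ?_⟩
  exact (Ext.mk₀_comp_mk₀ _ _).symm.trans hγ

/-- The connecting homomorphism `Hom(N, M / x M) → Ext^1(N, M)`. -/
noncomputable def homQuotSMulTopToExt (hx : IsSMulRegular M x) (N : Type u) [AddCommGroup N]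
    [Module R N] :
    (N →ₗ[R] QuotSMulTop x M) →ₗ[R] Ext (ModuleCat.of R N) (ModuleCat.of R M) 1 where
  toFun g := (Ext.mk₀ (ModuleCat.ofHom g)).comp (quotSMulTopExtClass hx) (zero_add 1)
  map_add' f g := by
    rw [← Ext.add_comp, ← Ext.mk₀_add]
    rfl
  map_smul' r g := by
    rw [RingHom.id_apply, ← Ext.smul_comp, ← Ext.mk₀_smul]
    rfl

/-- Since `x` kills `N`, it kills `Ext^1(N, M)`, so every class comes from the connecting map. -/
theorem homQuotSMulTopToExt_surjective (hx : IsSMulRegular M x) {N : Type u} [AddCommGroup N]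
    [Module R N] (hN : ∀ y : N, x • y = 0) : Function.Surjective (homQuotSMulTopToExt hx N) := by
  intro β
  have h0 : x • 𝟙 (ModuleCat.of R N) = 0 := by
    ext y
    exact hN y
  obtain ⟨g, hg⟩ := exists_hom_comp_quotSMulTopExtClass hx β (by
    rw [← Ext.mk₀_id_comp (x • β), Ext.comp_smul, ← Ext.smul_comp, ← Ext.mk₀_smul, h0,
      Ext.mk₀_zero, Ext.zero_comp])
  exact ⟨g.hom, hg⟩

/-- The kernel consists of maps that lift to `N → M`; such lifts vanish because `x` kills `N` and is
regular on `M`. -/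
theorem homQuotSMulTopToExt_injective (hx : IsSMulRegular M x) {N : Type u} [AddCommGroup N]
    [Module R N] (hN : ∀ y : N, x • y = 0) : Function.Injective (homQuotSMulTopToExt hx N) := by
  refine (injective_iff_map_eq_zero _).2 fun g hg => ?_
  obtain ⟨h, hh⟩ := exists_hom_eq_of_comp_quotSMulTopExtClass hx (ModuleCat.ofHom g) hg
  have h0 (y : N) : h.hom y = 0 := by
    apply hx
    change x • h.hom y = x • 0
    rw [smul_zero, ← map_smul h.hom x y, hN, map_zero]
  ext y
  have := LinearMap.congr_fun (congrArg ModuleCat.Hom.hom hh) y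
  change Submodule.mkQ _ (h.hom y) = g y at this
  rw [← this, h0, map_zero, LinearMap.zero_apply]

/-- If `x` kills `N`, then `Hom(N, M / x M) ≃ Ext^1(N, M)`. -/
noncomputable def homQuotSMulTopEquivExt (hx : IsSMulRegular M x) (N : Type u) [AddCommGroup N]
    [Module R N] (hN : ∀ y : N, x • y = 0) :
    (N →ₗ[R] QuotSMulTop x M) ≃ₗ[R] Ext (ModuleCat.of R N) (ModuleCat.of R M) 1 :=
  LinearEquiv.ofBijective (homQuotSMulTopToExt hx N)
    ⟨homQuotSMulTopToExt_injective hx hN, homQuotSMulTopToExt_surjective hx hN⟩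

theorem smul_quotient_span_singleton_eq_zero (x : R) (y : R ⧸ Ideal.span {x}) : x • y = 0 := by
  obtain ⟨y, rfl⟩ := Ideal.Quotient.mk_surjective y
  exact Ideal.Quotient.eq_zero_iff_mem.2 (Ideal.mul_mem_right _ _
    (Ideal.mem_span_singleton_self x))

/-- Through `Hom(-, M/xM) ≃ Ext^1(-, M)`, extending a map from `P` to `N` means lifting a class
along `Ext^1(N, M) → Ext^1(P, M)`; the obstruction lies in `Ext^2(N/P, M)`. -/
theorem exists_extend_of_ext_two_subsingleton (hx : IsSMulRegular M x) {N : Type u}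
    [AddCommGroup N] [Module R N] (hN : ∀ y : N, x • y = 0) (P : Submodule R N)
    (hext : Subsingleton (Ext (ModuleCat.of R (N ⧸ P)) (ModuleCat.of R M) 2))
    (f : P →ₗ[R] QuotSMulTop x M) : ∃ g : N →ₗ[R] QuotSMulTop x M, g ∘ₗ P.subtype = f := by
  obtain ⟨β, hβ⟩ := Ext.contravariant_sequence_exact₁ (moduleCat_shortExact_of_submodule P)
    (ModuleCat.of R M) (homQuotSMulTopToExt hx P f) (n₁ := 2) rfl (hext.elim _ _)
  obtain ⟨g, rfl⟩ := homQuotSMulTopToExt_surjective hx hN β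
  refine ⟨g, homQuotSMulTopToExt_injective hx (fun y => Subtype.ext (hN y)) ?_⟩
  rw [← hβ]
  exact (Ext.mk₀_comp_mk₀_assoc (ModuleCat.ofHom P.subtype) (ModuleCat.ofHom g)
    (quotSMulTopExtClass hx)).symm

theorem baer_quotSMulTop (hx : IsSMulRegular M x)
    (hext : ∀ P : Submodule R (R ⧸ Ideal.span {x}),
      Subsingleton (Ext (ModuleCat.of R ((R ⧸ Ideal.span {x}) ⧸ P)) (ModuleCat.of R M) 2)) :
    Module.Baer (R ⧸ Ideal.span {x}) (QuotSMulTop x M) := by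
  intro I f
  obtain ⟨g, hg⟩ := exists_extend_of_ext_two_subsingleton hx
    (smul_quotient_span_singleton_eq_zero x) (I.restrictScalars R) (hext _) (f.restrictScalars R)
  exact ⟨g.extendScalarsOfSurjective Ideal.Quotient.mk_surjective, fun a ha =>
    LinearMap.congr_fun hg ⟨a, ha⟩⟩

end RegularQuotient

/-! ### Modules with one-dimensional socle over a local ring. -/

section Socle

open IsLocalRing

/-- The socle of the module `M` over the local ring `A` is one-dimensional over the residue
field. -/
def HasOneDimensionalSocle (A : Type*) [CommRing A] [IsLocalRing A] (M : Type*) [AddCommGroup M]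
    [Module A M] : Prop :=
  ∃ s : M, s ≠ 0 ∧ (∀ a ∈ maximalIdeal A, a • s = 0) ∧
    ∀ t : M, (∀ a ∈ maximalIdeal A, a • t = 0) → t ∈ Submodule.span A {s}

variable {A : Type u} [CommRing A] [IsLocalRing A] {M : Type u} [AddCommGroup M] [Module A M]

theorem exists_linearMap_quotient_maximalIdeal {s : M} (hs : ∀ a ∈ maximalIdeal A, a • s = 0) :
    ∃ f : (A ⧸ maximalIdeal A) →ₗ[A] M, f (Ideal.Quotient.mk _ 1) = s ∧
      (s ≠ 0 → Function.Injective f) := by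
  refine ⟨Submodule.liftQ (maximalIdeal A) (LinearMap.toSpanSingleton A M s) fun a ha => hs a ha,
    one_smul A s, fun h0 => ?_⟩
  rw [← LinearMap.ker_eq_bot, Submodule.ker_liftQ_eq_bot']
  refine le_antisymm (fun a ha => hs a ha) fun a ha => ?_
  by_contra hu
  exact h0 ((notMem_maximalIdeal.1 hu).smul_eq_zero.1 ha)

theorem linearMap_quotient_maximalIdeal_ext {f g : (A ⧸ maximalIdeal A) →ₗ[A] M}
    (h : f (Ideal.Quotient.mk _ 1) = g (Ideal.Quotient.mk _ 1)) : f = g := by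
  ext
  exact h

theorem smul_map_quotient_maximalIdeal (f : (A ⧸ maximalIdeal A) →ₗ[A] M)
    (y : A ⧸ maximalIdeal A) {a : A} (ha : a ∈ maximalIdeal A) : a • f y = 0 := by
  obtain ⟨y, rfl⟩ := Ideal.Quotient.mk_surjective y
  rw [← map_smul]
  have : a • (Ideal.Quotient.mk (maximalIdeal A) y) = 0 :=
    Ideal.Quotient.eq_zero_iff_mem.2 (Ideal.mul_mem_right _ _ ha)
  rw [this, map_zero]

theorem length_hom_quotient_maximalIdeal_eq_one_iff :
    Module.length A ((A ⧸ maximalIdeal A) →ₗ[A] M) = 1 ↔ HasOneDimensionalSocle A M := by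
  rw [Module.length_eq_one_iff, isSimpleModule_iff_toSpanSingleton_surjective]
  constructor
  · rintro ⟨hnt, h⟩
    obtain ⟨f, hf⟩ := exists_ne (0 : (A ⧸ maximalIdeal A) →ₗ[A] M)
    refine ⟨f (Ideal.Quotient.mk _ 1), fun h0 => hf (linearMap_quotient_maximalIdeal_ext h0),
      fun a ha => smul_map_quotient_maximalIdeal f _ ha, fun t ht => ?_⟩
    obtain ⟨g, hg, -⟩ := exists_linearMap_quotient_maximalIdeal ht
    obtain ⟨c, hc⟩ := h f hf g
    rw [← hg, ← hc]
    exact Submodule.mem_span_singleton.2 ⟨c, rfl⟩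
  · rintro ⟨s, h0, hs, h⟩
    obtain ⟨f, hf, -⟩ := exists_linearMap_quotient_maximalIdeal hs
    refine ⟨⟨f, 0, fun hf0 => h0 (by rw [← hf, hf0, LinearMap.zero_apply])⟩, fun g hg k => ?_⟩
    obtain ⟨c, hc⟩ := Submodule.mem_span_singleton.1
      (h (g (Ideal.Quotient.mk _ 1)) fun a ha => smul_map_quotient_maximalIdeal g _ ha)
    obtain ⟨d, hd⟩ := Submodule.mem_span_singleton.1
      (h (k (Ideal.Quotient.mk _ 1)) fun a ha => smul_map_quotient_maximalIdeal k _ ha)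
    have hc' : c ∉ maximalIdeal A := fun hcm => hg
      (linearMap_quotient_maximalIdeal_ext (by rw [← hc, hs c hcm, LinearMap.zero_apply]))
    obtain ⟨u, rfl⟩ := notMem_maximalIdeal.1 hc'
    refine ⟨d * ↑u⁻¹, linearMap_quotient_maximalIdeal_ext ?_⟩
    change (d * ↑u⁻¹) • g _ = _
    rw [← hd, ← hc, smul_smul, mul_assoc, Units.inv_mul, mul_one]

theorem length_ext_zero_eq_one_iff :
    Module.length A (Abelian.Ext (ModuleCat.of A (ResidueField A)) (ModuleCat.of A M) 0) = 1 ↔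
      HasOneDimensionalSocle A M := by
  rw [← length_hom_quotient_maximalIdeal_eq_one_iff, ((Abelian.Ext.linearEquiv₀ (R := A)).trans
    (ModuleCat.homLinearEquiv (S := A))).length_eq]
  rfl

theorem length_ext_one_eq_one_iff {x : A} (hxm : x ∈ maximalIdeal A) (hx : IsSMulRegular M x) :
    Module.length A (Abelian.Ext (ModuleCat.of A (ResidueField A)) (ModuleCat.of A M) 1) = 1 ↔
      HasOneDimensionalSocle A (QuotSMulTop x M) := by
  rw [← length_hom_quotient_maximalIdeal_eq_one_iff]
  have e := homQuotSMulTopEquivExt hx (A ⧸ maximalIdeal A) fun y => by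
    obtain ⟨y, rfl⟩ := Ideal.Quotient.mk_surjective y
    exact Ideal.Quotient.eq_zero_iff_mem.2 (Ideal.mul_mem_right _ _ hxm)
  rw [e.length_eq]
  rfl

theorem exists_linearEquiv_quotient_maximalIdeal {S : Type*} [AddCommGroup S] [Module A S]
    (hS : IsSimpleModule A S) : Nonempty (S ≃ₗ[A] A ⧸ maximalIdeal A) := by
  obtain ⟨I, hI, ⟨e⟩⟩ := isSimpleModule_iff_quot_maximal.1 hS
  obtain rfl := eq_maximalIdeal hI
  exact ⟨e⟩

/-- Induction along a composition series: `Hom(-, M)` is left exact, and each simple factor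
contributes length exactly one. -/
theorem length_hom_le_of_hasOneDimensionalSocle (h : HasOneDimensionalSocle A M) {N : Type u}
    [AddCommGroup N] [Module A N] (hN : IsFiniteLength A N) :
    Module.length A (N →ₗ[A] M) ≤ Module.length A N := by
  induction hN with
  | of_subsingleton => rw [Module.length_eq_zero]; exact zero_le
  | @of_simple_quotient N _ _ P hs _ ih =>
    obtain ⟨e⟩ := exists_linearEquiv_quotient_maximalIdeal hs
    have h1 : Module.length A ((N ⧸ P) →ₗ[A] M) = 1 := by
      rw [← length_hom_quotient_maximalIdeal_eq_one_iff] at h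
      rw [← h]
      exact (e.arrowCongr (LinearEquiv.refl A M)).length_eq
    let r : (N →ₗ[A] M) →ₗ[A] (P →ₗ[A] M) := LinearMap.lcomp A M P.subtype
    let q : ((N ⧸ P) →ₗ[A] M) →ₗ[A] (N →ₗ[A] M) := LinearMap.lcomp A M P.mkQ
    have hker : LinearMap.ker r ≤ LinearMap.range q := by
      intro f hf
      have hPf : P ≤ LinearMap.ker f := fun y hy =>
        LinearMap.congr_fun (LinearMap.mem_ker.1 hf) ⟨y, hy⟩
      exact ⟨P.liftQ f hPf, P.liftQ_mkQ f hPf⟩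
    have h2 : Module.length A (LinearMap.ker r) ≤ 1 := by
      rw [← h1]
      exact (Module.length_le_of_injective _ (Submodule.inclusion_injective hker)).trans
        (Module.length_le_of_surjective q.rangeRestrict q.surjective_rangeRestrict)
    rw [Module.length_eq_add_of_exact (LinearMap.ker r).subtype r.rangeRestrict
      (Submodule.injective_subtype _) r.surjective_rangeRestrict (by
        rw [LinearMap.exact_iff, LinearMap.ker_rangeRestrict, Submodule.range_subtype]),
      Module.length_eq_add_of_exact P.subtype P.mkQ P.injective_subtype P.mkQ_surjective
        (LinearMap.exact_subtype_mkQ P), add_comm, Module.length_eq_one (R := A) (M := N ⧸ P)]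
    exact add_le_add ((Module.length_le_of_injective _ (Submodule.injective_subtype _)).trans ih) h2

theorem length_le_of_hasOneDimensionalSocle [IsArtinianRing A] (h : HasOneDimensionalSocle A M) :
    Module.length A M ≤ Module.length A A := by
  rw [← (LinearMap.ringLmapEquivSelf A A M).length_eq]
  exact length_hom_le_of_hasOneDimensionalSocle h
    (isFiniteLength_iff_isNoetherian_isArtinian.2 ⟨inferInstance, inferInstance⟩)

/-- The socle is essential: as `𝔪` is nilpotent, there is a last power of `𝔪` not killing `t`, and a
suitable element of it moves `t` into the socle. -/
theorem exists_smul_ne_zero_of_isArtinianRing [IsArtinianRing A] {t : M} (ht : t ≠ 0) :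
    ∃ c : A, c • t ≠ 0 ∧ ∀ a ∈ maximalIdeal A, a • c • t = 0 := by
  classical
  obtain ⟨n, hn⟩ : IsNilpotent (maximalIdeal A) := by
    rw [← jacobson_eq_maximalIdeal (⊥ : Ideal A) bot_ne_top]
    exact IsArtinianRing.isNilpotent_jacobson_bot
  have hex : ∃ n, ∀ a ∈ maximalIdeal A ^ n, a • t = 0 := ⟨n, fun a ha => by
    rw [hn] at ha
    rw [(Submodule.mem_bot A).1 ha, zero_smul]⟩
  have h0 : Nat.find hex ≠ 0 := fun h => ht (by
    simpa using Nat.find_spec hex 1 (by simp [h]))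
  obtain ⟨k, hk⟩ := Nat.exists_eq_succ_of_ne_zero h0
  have h1 := Nat.find_min hex (m := k) (by lia)
  push Not at h1
  obtain ⟨c, hc, hct⟩ := h1
  refine ⟨c, hct, fun a ha => ?_⟩
  rw [smul_smul]
  refine Nat.find_spec hex _ ?_
  rw [hk, pow_succ']
  exact Ideal.mul_mem_mul ha hc

theorem exists_injective_of_isSimpleModule [IsArtinianRing A] [Nontrivial M] {S : Type*}
    [AddCommGroup S] [Module A S] (hS : IsSimpleModule A S) :
    ∃ f : S →ₗ[A] M, Function.Injective f := by
  obtain ⟨e⟩ := exists_linearEquiv_quotient_maximalIdeal hS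
  obtain ⟨t, ht⟩ := exists_ne (0 : M)
  obtain ⟨c, hc, hct⟩ := exists_smul_ne_zero_of_isArtinianRing (A := A) ht
  obtain ⟨f, -, hf⟩ := exists_linearMap_quotient_maximalIdeal hct
  exact ⟨f ∘ₗ e.toLinearMap, (hf hc).comp e.injective⟩

/-- Injectivity of `N` extends a map matching the socle generators to all of `M`. It is nonzero on
the one-dimensional socle, which meets every nonzero submodule. -/
theorem HasOneDimensionalSocle.exists_injective [IsArtinianRing A] {N : Type u} [AddCommGroup N]
    [Module A N] (hM : HasOneDimensionalSocle A M) (hN : HasOneDimensionalSocle A N)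
    (hb : Module.Baer A N) : ∃ f : M →ₗ[A] N, Function.Injective f := by
  obtain ⟨s, hs0, hs, hspan⟩ := hM
  obtain ⟨t, ht0, ht, -⟩ := hN
  obtain ⟨i, hi1, hi⟩ := exists_linearMap_quotient_maximalIdeal hs
  obtain ⟨j, hj1, -⟩ := exists_linearMap_quotient_maximalIdeal ht
  have hinj := hb.injective
  obtain ⟨f, hf⟩ := Module.Injective.extension_property A _ _ _ i (hi hs0) j
  have hfs : f s = t := by rw [← hi1, ← hj1, ← hf]; rfl
  refine ⟨f, (injective_iff_map_eq_zero f).2 fun y hy => ?_⟩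
  by_contra hy0
  obtain ⟨c, hc, hcy⟩ := exists_smul_ne_zero_of_isArtinianRing (A := A) hy0
  obtain ⟨d, hd⟩ := Submodule.mem_span_singleton.1 (hspan _ hcy)
  have hdt : d • t = 0 := by rw [← hfs, ← map_smul, hd, map_smul, hy, smul_zero]
  refine hc ?_
  rw [← hd]
  refine hs d fun hu => ?_
  exact ht0 (hu.smul_eq_zero.1 hdt)

/-- Two finitely generated injective modules with one-dimensional socle over an artinian local ring
are isomorphic. -/
theorem HasOneDimensionalSocle.nonempty_linearEquiv [IsArtinianRing A] [Module.Finite A M]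
    {N : Type u} [AddCommGroup N] [Module A N] [Module.Finite A N]
    (hM : HasOneDimensionalSocle A M) (hbM : Module.Baer A M)
    (hN : HasOneDimensionalSocle A N) (hbN : Module.Baer A N) : Nonempty (M ≃ₗ[A] N) := by
  obtain ⟨f, hf⟩ := hM.exists_injective hN hbN
  obtain ⟨g, hg⟩ := hN.exists_injective hM hbM
  have h : Function.Surjective (f ∘ₗ g) :=
    IsArtinian.surjective_of_injective_endomorphism _ (hf.comp hg)
  exact ⟨LinearEquiv.ofBijective f ⟨hf, Function.Surjective.of_comp h⟩⟩

/-- A nonzero `a` has a multiple `ca` in the socle of `A`. Injectivity of `M` yields `f : A → M`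
sending `ca` to a nonzero socle element, yet `f (ca) = c a f(1) = 0`. -/
theorem HasOneDimensionalSocle.eq_zero_of_smul_eq_zero [IsArtinianRing A]
    (hM : HasOneDimensionalSocle A M) (hb : Module.Baer A M) {a : A} (ha : ∀ y : M, a • y = 0) :
    a = 0 := by
  by_contra h0
  obtain ⟨c, hc, hca⟩ := exists_smul_ne_zero_of_isArtinianRing (A := A) h0
  obtain ⟨s, hs0, hs, -⟩ := hM
  obtain ⟨i, hi1, hi⟩ := exists_linearMap_quotient_maximalIdeal hca
  obtain ⟨j, hj1, -⟩ := exists_linearMap_quotient_maximalIdeal hs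
  have hinj := hb.injective
  obtain ⟨f, hf⟩ := Module.Injective.extension_property A _ _ _ i (hi hc) j
  apply hs0
  rw [← hj1, ← hf, LinearMap.comp_apply, hi1, map_smul]
  have : f a = a • f 1 := by rw [← map_smul, smul_eq_mul, mul_one]
  rw [this, ha, smul_zero]

theorem hasOneDimensionalSocle_quotient_iff {x : A} [IsLocalRing (A ⧸ Ideal.span {x})]
    [Module (A ⧸ Ideal.span {x}) M] [IsScalarTower A (A ⧸ Ideal.span {x}) M] :
    HasOneDimensionalSocle (A ⧸ Ideal.span {x}) M ↔ HasOneDimensionalSocle A M := by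
  have hmk (a : A) (t : M) : Ideal.Quotient.mk (Ideal.span {x}) a • t = a • t := by
    rw [← Ideal.Quotient.algebraMap_eq, algebraMap_smul]
  have hm (t : M) : (∀ a ∈ maximalIdeal (A ⧸ Ideal.span {x}), a • t = 0) ↔
      ∀ a ∈ maximalIdeal A, a • t = 0 := by
    have hloc : IsLocalHom (Ideal.Quotient.mk (Ideal.span {x})) :=
      .of_surjective _ Ideal.Quotient.mk_surjective
    constructor
    · intro h a ha
      rw [← hmk]
      exact h _ fun hu => ha (isUnit_of_map_unit (Ideal.Quotient.mk (Ideal.span {x})) a hu)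
    · intro h a ha
      obtain ⟨a, rfl⟩ := Ideal.Quotient.mk_surjective a
      rw [hmk]
      exact h a fun hu => ha (hu.map _)
  have hspan (s t : M) : t ∈ Submodule.span (A ⧸ Ideal.span {x}) {s} ↔ t ∈ Submodule.span A {s} := by
    simp only [Submodule.mem_span_singleton, Ideal.Quotient.mk_surjective.exists, hmk]
  simp only [HasOneDimensionalSocle, hm, hspan]

end Socle

/-! ### Weak almost Gorensteinness as an inclusion `𝔪M ⊆ Aw`. -/

section WeaklyAlmostGorenstein

open IsLocalRing

variable {A : Type u} [CommRing A] [IsLocalRing A] {M : Type u} [AddCommGroup M] [Module A M]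

theorem maximalIdeal_smul_top_le_of_exact {n : ℕ} {f : A →ₗ[A] M}
    {g : M →ₗ[A] (Fin n → ResidueField A)} (h : Function.Exact f g) :
    maximalIdeal A • (⊤ : Submodule A M) ≤ Submodule.span A {f 1} := by
  rw [Submodule.smul_le]
  intro a ha z _
  have h0 : g (a • z) = 0 := by
    rw [map_smul]
    ext i
    have : residue A a = 0 := (residue_eq_zero_iff a).2 ha
    rw [Pi.smul_apply, Algebra.smul_def, ResidueField.algebraMap_eq, this, zero_mul, Pi.zero_apply]
  obtain ⟨r, hr⟩ := (h _).1 h0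
  rw [← hr]
  exact Submodule.mem_span_singleton.2 ⟨r, by rw [← map_smul, smul_eq_mul, mul_one]⟩

/-- `M/Aw` is killed by the maximal ideal, hence is a finite-dimensional vector space over the
residue field; a basis gives the exact sequence. -/
theorem exists_exact_of_maximalIdeal_smul_top_le [Module.Finite A M] {w : M}
    (hw : maximalIdeal A • (⊤ : Submodule A M) ≤ Submodule.span A {w}) :
    ∃ (n : ℕ) (f : A →ₗ[A] M) (g : M →ₗ[A] (Fin n → ResidueField A)),
      Function.Exact f g ∧ Function.Surjective g := by
  have ht : Module.IsTorsionBySet A (M ⧸ Submodule.span A {w}) (maximalIdeal A) := by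
    rw [Module.isTorsionBySet_quotient_iff]
    exact fun z r hr => hw (Submodule.smul_mem_smul hr trivial)
  let i1 : Module (ResidueField A) (M ⧸ Submodule.span A {w}) := ht.module
  have i2 : IsScalarTower A (ResidueField A) (M ⧸ Submodule.span A {w}) := ht.isScalarTower
  have i3 : Module.Finite (ResidueField A) (M ⧸ Submodule.span A {w}) :=
    Module.Finite.of_restrictScalars_finite A _ _
  let e := (Module.finBasis (ResidueField A) (M ⧸ Submodule.span A {w})).equivFun.restrictScalars A
  refine ⟨_, LinearMap.toSpanSingleton A M w,
    e.toLinearMap ∘ₗ (Submodule.span A {w}).mkQ, ?_,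
    e.surjective.comp (Submodule.mkQ_surjective _)⟩
  rw [LinearMap.exact_iff, LinearEquiv.ker_comp, Submodule.ker_mkQ, LinearMap.range_toSpanSingleton]

end WeaklyAlmostGorenstein

/-! ### Finite length and quotients by a regular element in dimension one. -/

section FiniteLength

open IsLocalRing

variable {R : Type u} [CommRing R]

theorem isFiniteLength_of_smul_eq_zero {y : R} [IsArtinianRing (R ⧸ Ideal.span {y})]
    {C : Type u} [AddCommGroup C] [Module R C] [Module.Finite R C] (hC : ∀ z : C, y • z = 0) :
    IsFiniteLength R C := by
  let i1 : Module (R ⧸ Ideal.span {y}) C := Module.IsTorsionBy.module hC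
  have i2 : IsScalarTower R (R ⧸ Ideal.span {y}) C :=
    Module.IsTorsionBySet.isScalarTower ((Module.isTorsionBySet_span_singleton_iff y).2 hC)
  have i3 : Module.Finite (R ⧸ Ideal.span {y}) C := Module.Finite.of_restrictScalars_finite R _ _
  rw [← Module.length_ne_top_iff,
    Module.length_eq_of_surjective (R := R ⧸ Ideal.span {y}) Ideal.Quotient.mk_surjective]
  exact Module.length_ne_top

theorem length_quotient_range_comp {U V Z : Type u} [AddCommGroup U] [Module R U] [AddCommGroup V]
    [Module R V] [AddCommGroup Z] [Module R Z] (i : U →ₗ[R] V) (j : V →ₗ[R] Z)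
    (hj : Function.Injective j) :
    Module.length R (Z ⧸ LinearMap.range (j ∘ₗ i)) =
      Module.length R (V ⧸ LinearMap.range i) + Module.length R (Z ⧸ LinearMap.range j) := by
  refine Module.length_eq_add_of_exact
    (Submodule.mapQ _ _ j (by rw [LinearMap.range_comp]; exact Submodule.le_comap_map _ _))
    (Submodule.factor (LinearMap.range_comp_le_range i j)) ?_ (Submodule.factor_surjective _) ?_
  · rw [← LinearMap.ker_eq_bot, Submodule.ker_mapQ, LinearMap.range_comp,
      Submodule.comap_map_eq_of_injective hj, Submodule.mkQ_map_self]
  · rw [LinearMap.exact_iff]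
    simp [Submodule.factor, Submodule.ker_mapQ, Submodule.range_mapQ]

theorem isArtinianRing_of_ringKrullDim_le_zero {A : Type*} [CommRing A] [IsNoetherianRing A]
    (h : ringKrullDim A ≤ 0) : IsArtinianRing A := by
  rw [isArtinianRing_iff_krullDimLE_zero]
  exact Ring.krullDimLE_iff.2 h

variable [IsLocalRing R]

theorem ringKrullDim_quotient_span_singleton_eq_zero [IsNoetherianRing R]
    (hdim : ringKrullDim R = 1) {x : R} (hxm : x ∈ maximalIdeal R) (hx : IsSMulRegular R x) :
    ringKrullDim (R ⧸ Ideal.span {x}) = 0 := by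
  have h := ringKrullDim_quotient_span_singleton_succ_eq_ringKrullDim hx hxm
  rw [hdim] at h
  have hnt : Nontrivial (R ⧸ Ideal.span {x}) := Ideal.Quotient.nontrivial_iff.2 fun ht =>
    (maximalIdeal.isMaximal R).ne_top (top_le_iff.1 (ht ▸ (Ideal.span_singleton_le_iff_mem _).2 hxm))
  have h0 := ringKrullDim_nonneg_of_nontrivial (R := R ⧸ Ideal.span {x})
  generalize ringKrullDim (R ⧸ Ideal.span {x}) = d at h h0
  induction d with
  | bot => simp at h0
  | coe d =>
    induction d with
    | top => simp at h; exact absurd h (by decide)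
    | coe d =>
      norm_cast at h ⊢
      simpa using h

theorem isArtinianRing_quotient_span_singleton [IsNoetherianRing R]
    (hdim : ringKrullDim R = 1) {x : R} (hxm : x ∈ maximalIdeal R) (hx : IsSMulRegular R x) :
    IsArtinianRing (R ⧸ Ideal.span {x}) :=
  isArtinianRing_of_ringKrullDim_le_zero
    (ringKrullDim_quotient_span_singleton_eq_zero hdim hxm hx).le

theorem isLocalRing_quotient_span_singleton {x : R} (hxm : x ∈ maximalIdeal R) :
    IsLocalRing (R ⧸ Ideal.span {x}) := by
  have hnt : Nontrivial (R ⧸ Ideal.span {x}) := Ideal.Quotient.nontrivial_iff.2 fun ht =>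
    (maximalIdeal.isMaximal R).ne_top (top_le_iff.1 (ht ▸ (Ideal.span_singleton_le_iff_mem _).2 hxm))
  exact .of_surjective' (Ideal.Quotient.mk _) Ideal.Quotient.mk_surjective

theorem exists_maximalIdeal_pow_le_span_singleton [IsNoetherianRing R]
    (hdim : ringKrullDim R = 1) {x : R} (hxm : x ∈ maximalIdeal R) (hx : IsSMulRegular R x) :
    ∃ n, maximalIdeal R ^ n ≤ Ideal.span {x} := by
  have := isArtinianRing_quotient_span_singleton hdim hxm hx
  have hloc := isLocalRing_quotient_span_singleton hxm
  obtain ⟨n, hn⟩ : IsNilpotent (maximalIdeal (R ⧸ Ideal.span {x})) := by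
    rw [← jacobson_eq_maximalIdeal (⊥ : Ideal _) bot_ne_top]
    exact IsArtinianRing.isNilpotent_jacobson_bot
  have hle : (maximalIdeal R).map (Ideal.Quotient.mk (Ideal.span {x})) ≤
      maximalIdeal (R ⧸ Ideal.span {x}) := by
    have hl : IsLocalHom (Ideal.Quotient.mk (Ideal.span {x})) :=
      .of_surjective _ Ideal.Quotient.mk_surjective
    exact Ideal.map_le_iff_le_comap.2 fun a ha hu => ha (isUnit_of_map_unit _ a hu)
  refine ⟨n, ?_⟩
  have h0 : (maximalIdeal R ^ n).map (Ideal.Quotient.mk (Ideal.span {x})) = ⊥ := by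
    rw [Ideal.map_pow, eq_bot_iff, ← Ideal.zero_eq_bot, ← hn]
    exact Ideal.pow_right_mono hle n
  rwa [Ideal.map_eq_bot_iff_le_ker, Ideal.mk_ker] at h0

/-- If `C` is the cokernel of an injective homomorphism `R → ω`, where `R` is one-dimensional
and `length (ω / x ω) ≤ length (R / x R)`, then `C` is killed by a power of `x`. -/
theorem exists_pow_smul_eq_zero_of_length_le [IsNoetherianRing R]
    (hdim : ringKrullDim R = 1) {x : R} (hxm : x ∈ maximalIdeal R) (hx : IsSMulRegular R x)
    {ω C : Type u} [AddCommGroup ω] [Module R ω] [Module.Finite R ω] [AddCommGroup C] [Module R C]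
    (hxω : IsSMulRegular ω x)
    (hlen : Module.length R (ω ⧸ LinearMap.range (LinearMap.lsmul R ω x)) ≤
      Module.length R (R ⧸ LinearMap.range (LinearMap.lsmul R R x)))
    {f : R →ₗ[R] ω} {g : ω →ₗ[R] C} (hf : Function.Injective f) (hfg : Function.Exact f g)
    (hg : Function.Surjective g) : ∃ n, ∀ c : C, x ^ (n + 1) • c = 0 := by
  have hCfin : Module.Finite R C := Module.Finite.of_surjective g hg
  -- The `x`-power torsion of the noetherian module `C` is killed by a single power of `x`.
  obtain ⟨N, hN⟩ : ∃ N, ∀ n, ∀ c : C, x ^ n • c = 0 → x ^ N • c = 0 := by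
    let T : ℕ →o Submodule R C :=
      ⟨fun n => Submodule.torsionBy R C (x ^ n), fun m n hmn c hc => by
        rw [Submodule.mem_torsionBy_iff] at hc ⊢
        rw [← Nat.sub_add_cancel hmn, pow_add, mul_smul, hc, smul_zero]⟩
    obtain ⟨N, hN⟩ := monotone_stabilizes_iff_noetherian.2 (inferInstance : IsNoetherian R C) T
    refine ⟨N, fun n c hc => ?_⟩
    have h1 : c ∈ T (max N n) := T.mono (le_max_right N n) hc
    rw [← hN _ (le_max_left N n)] at h1
    exact h1
  -- `W` is the saturation of `f(R)` with respect to `x`: `W/f(R)` is `x`-power torsion and `ω/W`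
  -- has no `x`-torsion. The goal is `W = ω`.
  let W : Submodule R ω := (Submodule.torsionBy R C (x ^ N)).comap g
  have hW {z : ω} : z ∈ W ↔ x ^ N • g z = 0 := Iff.rfl
  have hxN : ∀ z : ω, x • z ∈ W → z ∈ W := by
    intro z hz
    rw [hW] at hz ⊢
    refine hN (N + 1) _ ?_
    rwa [pow_succ, mul_smul, ← map_smul]
  have hfW : ∀ r, f r ∈ W := fun r => by
    rw [hW, hfg.apply_apply_eq_zero, smul_zero]
  let f' : R →ₗ[R] W := f.codRestrict W hfW
  have hf' : Function.Injective f' := fun a b hab => hf (congrArg Subtype.val hab)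
  let xW : W →ₗ[R] W := LinearMap.lsmul R W x
  have hxW : Function.Injective xW := fun a b hab => Subtype.ext (hxω (congrArg Subtype.val hab))
  have hart : IsArtinianRing (R ⧸ Ideal.span {x ^ (N + 1)}) :=
    isArtinianRing_quotient_span_singleton hdim (Ideal.pow_mem_of_mem _ hxm _ N.succ_pos)
      (hx.pow _)
  have hfl : Module.length R (W ⧸ LinearMap.range f') ≠ ⊤ := by
    rw [Module.length_ne_top_iff]
    refine isFiniteLength_of_smul_eq_zero (y := x ^ (N + 1)) fun z => ?_
    obtain ⟨z, rfl⟩ := Submodule.mkQ_surjective _ z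
    rw [← map_smul]
    refine (Submodule.Quotient.mk_eq_zero _).2 ?_
    obtain ⟨r, hr⟩ := (hfg (x ^ (N + 1) • z.1)).1 (by
      rw [map_smul, pow_succ', mul_smul, hW.1 z.2, smul_zero])
    exact ⟨r, Subtype.ext hr⟩
  have hcomm : f' ∘ₗ LinearMap.lsmul R R x = xW ∘ₗ f' := by
    ext
    change f (x • 1) = x • f 1
    rw [map_smul]
  -- Computing the length of `W/x f(R)` through `f(R)` and through `xW`, then cancelling the finite
  -- length of `W/f(R)`, gives `length (W/xW) = length (R/(x))`.
  have h1 := length_quotient_range_comp (LinearMap.lsmul R R x) f' hf'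
  rw [hcomm, length_quotient_range_comp f' xW hxW, add_comm] at h1
  have h2 := ENat.add_left_injective_of_ne_top hfl h1
  rw [← h2] at hlen
  have hlenfin : Module.length R (W ⧸ LinearMap.range xW) ≠ ⊤ := by
    rw [h2, Module.length_ne_top_iff]
    have := isArtinianRing_quotient_span_singleton hdim hxm hx
    refine isFiniteLength_of_smul_eq_zero (y := x) fun z => ?_
    obtain ⟨z, rfl⟩ := Submodule.mkQ_surjective _ z
    rw [← map_smul]
    exact (Submodule.Quotient.mk_eq_zero _).2 ⟨z, rfl⟩
  let φ : (W ⧸ LinearMap.range xW) →ₗ[R] (ω ⧸ LinearMap.range (LinearMap.lsmul R ω x)) :=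
    Submodule.mapQ _ _ W.subtype (by
      rintro _ ⟨w, rfl⟩
      exact ⟨w, rfl⟩)
  -- Injective because `ω/W` has no `x`-torsion; the length bound then makes it onto, so `ω = W +
  -- xω` and Nakayama applies.
  have hφ : Function.Injective φ := by
    refine (injective_iff_map_eq_zero φ).2 fun w hw => ?_
    obtain ⟨w, rfl⟩ := Submodule.mkQ_surjective _ w
    obtain ⟨z, hz⟩ := (Submodule.Quotient.mk_eq_zero _).1 hw
    have hzW : z ∈ W := hxN z (by
      change x • z = w.1 at hz
      rw [hz]
      exact w.2)
    exact (Submodule.Quotient.mk_eq_zero _).2 ⟨⟨z, hzW⟩, Subtype.ext hz⟩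
  have hadd := Module.length_eq_add_of_exact φ (LinearMap.range φ).mkQ hφ
    (Submodule.mkQ_surjective _) (LinearMap.exact_map_mkQ_range φ)
  rw [hadd] at hlen
  have h3 : Module.length R (_ ⧸ LinearMap.range φ) = 0 := by
    refine le_antisymm ?_ zero_le
    refine (ENat.add_le_add_iff_left hlenfin).1 ?_
    simpa using hlen
  rw [Module.length_eq_zero_iff, Submodule.Quotient.subsingleton_iff] at h3
  have htop : (⊤ : Submodule R ω) ≤ W := by
    refine Submodule.le_of_le_smul_of_le_jacobson_bot (I := maximalIdeal R) Module.Finite.fg_top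
      (maximalIdeal_le_jacobson _) fun z _ => ?_
    obtain ⟨w, hw⟩ : Submodule.mkQ _ z ∈ LinearMap.range φ := h3 ▸ Submodule.mem_top
    obtain ⟨w, rfl⟩ := Submodule.mkQ_surjective _ w
    obtain ⟨y, hy⟩ := (Submodule.Quotient.eq _).1 (hw : Submodule.Quotient.mk _ = _)
    change x • y = w.1 - z at hy
    rw [show z = w.1 + x • (-y) by rw [smul_neg, hy]; abel]
    exact Submodule.add_mem_sup w.2 (Submodule.smul_mem_smul hxm trivial)
  -- The exponent `N` already suffices; `N + 1` keeps the power of `x` inside the maximal ideal even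
  -- when `N = 0`.
  refine ⟨N, fun c => ?_⟩
  obtain ⟨z, rfl⟩ := hg c
  rw [pow_succ', mul_smul, hW.1 (htop trivial), smul_zero]

end FiniteLength

/-! ### Number of generators and multiplicity as lengths. -/

section Multiplicity

open IsLocalRing

variable {R : Type u} [CommRing R] [IsLocalRing R]

theorem minGenerators_eq_length (C : Type u) [AddCommGroup C] [Module R C] [Module.Finite R C] :
    (minGenerators R C : ℕ∞) = Module.length R (C ⧸ maximalIdeal R • (⊤ : Submodule R C)) := by
  let : Field (R ⧸ maximalIdeal R) := Ideal.Quotient.field _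
  have h := IsLocalRing.spanFinrank_eq_finrank_quotient (⊤ : Submodule R C) Module.Finite.fg_top
  have i3 : Module.Finite (R ⧸ maximalIdeal R)
      ((⊤ : Submodule R C) ⧸ maximalIdeal R • (⊤ : Submodule R (⊤ : Submodule R C))) :=
    Module.Finite.of_restrictScalars_finite R _ _
  rw [minGenerators, h, ← Module.length_eq_finrank,
    ← Module.length_eq_of_surjective (S := R) Ideal.Quotient.mk_surjective]
  refine (Submodule.Quotient.equiv _ _ Submodule.topEquiv ?_).length_eq
  rw [Submodule.map_smul'', Submodule.map_top, LinearEquiv.range]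

/-- `C` has dimension zero, and a power of `𝔪` lies in `(x)` and so kills `C`: the sequence defining
the multiplicity is eventually the constant `length C`. -/
theorem hasMultiplicity_iff_of_pow_smul_eq_zero [IsNoetherianRing R] (hdim : ringKrullDim R = 1)
    {x : R} (hxm : x ∈ maximalIdeal R) (hx : IsSMulRegular R x)
    {C : Type u} [AddCommGroup C] [Module R C] [Module.Finite R C] (hC : ∀ c : C, x • c = 0)
    (e : ℝ) : HasMultiplicity R C e ↔ e = (Module.length R C).toNat := by
  have h0 : moduleDim R C = 0 := by
    have hle : Module.supportDim R C ≤ 0 := by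
      rw [Module.supportDim_eq_ringKrullDim_quotient_annihilator,
        ← ringKrullDim_quotient_span_singleton_eq_zero hdim hxm hx]
      have hann : Ideal.span {x} ≤ Module.annihilator R C :=
        (Ideal.span_singleton_le_iff_mem _).2 (Module.mem_annihilator.2 hC)
      exact ringKrullDim_le_of_surjective (Ideal.Quotient.factor hann)
        (Ideal.Quotient.factor_surjective hann)
    rw [moduleDim]
    generalize Module.supportDim R C = d at hle
    induction d with
    | bot => rfl
    | coe d =>
      have : d = 0 := by simpa using hle
      rw [this]
      rfl
  obtain ⟨k, hk⟩ := exists_maximalIdeal_pow_le_span_singleton hdim hxm hx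
  have hev : ∀ᶠ n : ℕ in Filter.atTop, ((moduleDim R C).factorial : ℝ) *
      ((Module.length R (C ⧸ (maximalIdeal R ^ (n + 1) • (⊤ : Submodule R C)))).toNat : ℝ) /
      (n : ℝ) ^ moduleDim R C = (Module.length R C).toNat := by
    filter_upwards [Filter.eventually_ge_atTop k] with n hn
    have hbot : maximalIdeal R ^ (n + 1) • (⊤ : Submodule R C) = ⊥ := by
      rw [eq_bot_iff, Submodule.smul_le]
      intro r hr c _
      obtain ⟨s, rfl⟩ := Ideal.mem_span_singleton'.1
        (hk (Ideal.pow_le_pow_right (by lia : k ≤ n + 1) hr))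
      rw [mul_smul, hC, smul_zero]
      exact Submodule.zero_mem _
    rw [h0, hbot, (Submodule.quotEquivOfEqBot (⊥ : Submodule R C) rfl).length_eq]
    simp
  have ht := tendsto_const_nhds.congr' (hev.mono fun n hn => hn.symm)
  exact ⟨fun he => tendsto_nhds_unique he ht, fun he => he ▸ ht⟩

end Multiplicity

/-! ### Canonical modules in dimensions zero and one. -/

section CanonicalModule

open IsLocalRing Abelian
open scoped Pointwise

variable {A : Type u} [CommRing A] {M : Type u} [AddCommGroup M] [Module A M]

theorem baer_of_ext_one_subsingleton
    (hext : ∀ I : Ideal A, Subsingleton (Ext (ModuleCat.of A (A ⧸ I)) (ModuleCat.of A M) 1)) :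
    Module.Baer A M := by
  intro I f
  obtain ⟨β, hβ⟩ := Ext.contravariant_sequence_exact₁ (moduleCat_shortExact_of_submodule I)
    (ModuleCat.of A M) (Ext.mk₀ (ModuleCat.ofHom f)) (n₁ := 1) rfl ((hext I).elim _ _)
  obtain ⟨g, rfl⟩ := (Ext.mk₀_bijective _ _).2 β
  have h : ModuleCat.ofHom I.subtype ≫ g = ModuleCat.ofHom f :=
    (Ext.mk₀_bijective _ _).1 ((Ext.mk₀_comp_mk₀ _ _).symm.trans hβ)
  exact ⟨g.hom, fun a ha => LinearMap.congr_fun (congrArg ModuleCat.Hom.hom h) ⟨a, ha⟩⟩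

theorem isFiniteLength_of_isArtinianRing [IsArtinianRing A] [Module.Finite A M] :
    IsFiniteLength A M :=
  isFiniteLength_iff_isNoetherian_isArtinian.2 ⟨inferInstance, inferInstance⟩

variable [IsLocalRing A]

theorem IsCanonicalModule.hasOneDimensionalSocle_of_ringKrullDim_eq_zero
    (hM : IsCanonicalModule A M) (hdim : ringKrullDim A = 0) : HasOneDimensionalSocle A M := by
  obtain ⟨d, hd, hlen⟩ := hM.typeOne
  obtain rfl : d = 0 := by
    rw [hdim] at hd
    exact_mod_cast hd.symm
  exact length_ext_zero_eq_one_iff.1 hlen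

/-- The Ext vanishing criterion applies with `Q = A`, which is projective and contains a copy of
every simple module. -/
theorem IsCanonicalModule.baer_of_ringKrullDim_eq_zero [IsNoetherianRing A]
    (hM : IsCanonicalModule A M) (hdim : ringKrullDim A = 0) : Module.Baer A M := by
  have := isArtinianRing_of_ringKrullDim_le_zero hdim.le
  obtain ⟨n, hn⟩ := hM.finite_injectiveDimension
  have : Projective (ModuleCat.of A A) := ModuleCat.projective_of_free (Module.Basis.singleton Unit A)
  refine baer_of_ext_one_subsingleton fun I => ext_subsingleton_of_isFiniteLength
    (ModuleCat.of A M) (n + 1) A isFiniteLength_of_isArtinianRing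
    (fun S _ _ hS => exists_injective_of_isSimpleModule hS) 1 (fun i hi => ?_) le_rfl (A ⧸ I)
    isFiniteLength_of_isArtinianRing
  obtain ⟨i, rfl⟩ := Nat.exists_eq_add_of_le' hi
  exact Ext.subsingleton_of_projective _ _ _

theorem isMaximalCohenMacaulay_of_ringKrullDim_eq_zero [Module.Finite A M] [Nontrivial M]
    (hdim : ringKrullDim A = 0) : IsMaximalCohenMacaulay A M :=
  ⟨inferInstance, [], by simp, RingTheory.Sequence.IsRegular.nil A M, by simp [hdim]⟩

theorem isCanonicalModule_of_hasOneDimensionalSocle [Module.Finite A M]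
    (hdim : ringKrullDim A = 0) (hs : HasOneDimensionalSocle A M) (hb : Module.Baer A M) :
    IsCanonicalModule A M := by
  have hnt : Nontrivial M := ⟨⟨hs.choose, 0, hs.choose_spec.1⟩⟩
  refine ⟨isMaximalCohenMacaulay_of_ringKrullDim_eq_zero hdim,
    ⟨0, hdim, length_ext_zero_eq_one_iff.2 hs⟩, 0, ?_⟩
  have := hb.injective
  have := Module.injective_object_of_injective_module A M
  infer_instance

theorem IsMaximalCohenMacaulay.exists_isSMulRegular (hM : IsMaximalCohenMacaulay A M)
    (hdim : ringKrullDim A = 1) : ∃ y ∈ maximalIdeal A, IsSMulRegular M y := by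
  obtain ⟨rs, hrs, hreg, hlen⟩ := hM.exists_isRegular
  rw [hdim] at hlen
  obtain ⟨y, rfl⟩ := List.length_eq_one_iff.1 (by exact_mod_cast hlen)
  exact ⟨y, hrs y (List.mem_singleton_self y),
    (RingTheory.Sequence.isWeaklyRegular_singleton_iff M y).1 hreg.toIsWeaklyRegular⟩

/-- Some `y` in the maximal ideal is regular on `M`, and a power of `y` is a multiple of `x`. -/
theorem IsMaximalCohenMacaulay.isSMulRegular [IsNoetherianRing A]
    (hM : IsMaximalCohenMacaulay A M) (hdim : ringKrullDim A = 1) {x : A}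
    (hxm : x ∈ maximalIdeal A) (hx : IsSMulRegular A x) : IsSMulRegular M x := by
  obtain ⟨y, hym, hy⟩ := hM.exists_isSMulRegular hdim
  obtain ⟨n, hn⟩ := exists_maximalIdeal_pow_le_span_singleton hdim hxm hx
  obtain ⟨a, ha⟩ := Ideal.mem_span_singleton'.1 (hn (Ideal.pow_mem_pow hym n))
  exact IsSMulRegular.of_mul (a := a) (ha ▸ hy.pow n)

variable [IsNoetherianRing A]

theorem IsCanonicalModule.hasOneDimensionalSocle_quotSMulTop (hM : IsCanonicalModule A M)
    (hdim : ringKrullDim A = 1) {x : A} (hxm : x ∈ maximalIdeal A) (hx : IsSMulRegular A x) :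
    HasOneDimensionalSocle A (QuotSMulTop x M) := by
  obtain ⟨d, hd, hlen⟩ := hM.typeOne
  obtain rfl : d = 1 := by
    rw [hdim] at hd
    exact_mod_cast hd.symm
  exact (length_ext_one_eq_one_iff hxm (hM.maximalCohenMacaulay.isSMulRegular hdim hxm hx)).1 hlen

/-- The Ext vanishing criterion applies with `Q = A/(x)`, which has projective dimension at most one
and, being artinian local, a nonzero socle. -/
theorem IsCanonicalModule.baer_quotSMulTop (hM : IsCanonicalModule A M)
    (hdim : ringKrullDim A = 1) {x : A} (hxm : x ∈ maximalIdeal A) (hx : IsSMulRegular A x) :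
    Module.Baer (A ⧸ Ideal.span {x}) (QuotSMulTop x M) := by
  have hart := isArtinianRing_quotient_span_singleton hdim hxm hx
  have hloc := isLocalRing_quotient_span_singleton hxm
  have hfl (N : Type u) [AddCommGroup N] [Module A N] [Module.Finite A N]
      (hN : ∀ y : N, x • y = 0) : IsFiniteLength A N := isFiniteLength_of_smul_eq_zero hN
  obtain ⟨n, hn⟩ := hM.finite_injectiveDimension
  refine _root_.baer_quotSMulTop (hM.maximalCohenMacaulay.isSMulRegular hdim hxm hx) fun P =>
    ext_subsingleton_of_isFiniteLength (ModuleCat.of A M) (n + 1) (A ⧸ Ideal.span {x})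
      (hfl _ (smul_quotient_span_singleton_eq_zero x)) (fun S _ _ hS => ?_) 2
      (fun i hi => ext_quotient_span_singleton_subsingleton x hx _ hi) le_rfl _
      ((hfl _ (smul_quotient_span_singleton_eq_zero x)).of_surjective P.mkQ_surjective)
  obtain ⟨e⟩ := exists_linearEquiv_quotient_maximalIdeal hS
  obtain ⟨c, hc, hcm⟩ := exists_smul_ne_zero_of_isArtinianRing
    (A := A ⧸ Ideal.span {x}) (one_ne_zero (α := A ⧸ Ideal.span {x}))
  obtain ⟨f, -, hf⟩ := exists_linearMap_quotient_maximalIdeal (A := A)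
    (s := c • (1 : A ⧸ Ideal.span {x})) fun a ha => by
      rw [← hcm (Ideal.Quotient.mk _ a) fun hu => ha (by
        have hl : IsLocalHom (Ideal.Quotient.mk (Ideal.span {x})) :=
          .of_surjective _ Ideal.Quotient.mk_surjective
        exact isUnit_of_map_unit _ a hu)]
      rfl
  exact ⟨f ∘ₗ e.toLinearMap, (hf hc).comp e.injective⟩

theorem IsCanonicalModule.quotSMulTop (hM : IsCanonicalModule A M)
    (hdim : ringKrullDim A = 1) {x : A} (hxm : x ∈ maximalIdeal A) (hx : IsSMulRegular A x)
    [IsLocalRing (A ⧸ Ideal.span {x})] :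
    IsCanonicalModule (A ⧸ Ideal.span {x}) (QuotSMulTop x M) := by
  have := hM.maximalCohenMacaulay.finite
  have : Module.Finite (A ⧸ Ideal.span {x}) (QuotSMulTop x M) :=
    Module.Finite.of_restrictScalars_finite A _ _
  exact isCanonicalModule_of_hasOneDimensionalSocle
    (ringKrullDim_quotient_span_singleton_eq_zero hdim hxm hx)
    (hasOneDimensionalSocle_quotient_iff.2 (hM.hasOneDimensionalSocle_quotSMulTop hdim hxm hx))
    (hM.baer_quotSMulTop hdim hxm hx)

theorem IsCanonicalModule.length_quotSMulTop_le (hM : IsCanonicalModule A M)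
    (hdim : ringKrullDim A = 1) {x : A} (hxm : x ∈ maximalIdeal A) (hx : IsSMulRegular A x) :
    Module.length A (QuotSMulTop x M) ≤ Module.length A (A ⧸ Ideal.span {x}) := by
  have := isArtinianRing_quotient_span_singleton hdim hxm hx
  have := isLocalRing_quotient_span_singleton hxm
  rw [Module.length_eq_of_surjective (R := A ⧸ Ideal.span {x}) Ideal.Quotient.mk_surjective,
    Module.length_eq_of_surjective (R := A ⧸ Ideal.span {x}) (M := A ⧸ Ideal.span {x})
      Ideal.Quotient.mk_surjective]
  exact length_le_of_hasOneDimensionalSocle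
    (hasOneDimensionalSocle_quotient_iff.2 (hM.hasOneDimensionalSocle_quotSMulTop hdim hxm hx))

/-- A canonical module is faithful. -/
theorem IsCanonicalModule.eq_zero_of_smul_eq_zero (hM : IsCanonicalModule A M)
    (hdim : ringKrullDim A = 1) {x : A} (hxm : x ∈ maximalIdeal A) (hx : IsSMulRegular A x)
    {a : A} (ha : ∀ z : M, a • z = 0) : a = 0 := by
  -- `a` kills `M/x^(n+1)M`, which is faithful over `A/(x^(n+1))`; Krull's intersection theorem
  -- finishes.
  have hmem (n : ℕ) : a ∈ Ideal.span {x ^ (n + 1)} := by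
    have hxm' : x ^ (n + 1) ∈ maximalIdeal A := Ideal.pow_mem_of_mem _ hxm _ n.succ_pos
    have hx' : IsSMulRegular A (x ^ (n + 1)) := hx.pow _
    have := isArtinianRing_quotient_span_singleton hdim hxm' hx'
    have := isLocalRing_quotient_span_singleton hxm'
    refine Ideal.Quotient.eq_zero_iff_mem.1
      ((hasOneDimensionalSocle_quotient_iff.2
        (hM.hasOneDimensionalSocle_quotSMulTop hdim hxm' hx')).eq_zero_of_smul_eq_zero
        (hM.baer_quotSMulTop hdim hxm' hx') fun y => ?_)
    obtain ⟨y, rfl⟩ := Submodule.mkQ_surjective _ y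
    change Submodule.mkQ _ (a • y) = 0
    rw [ha, map_zero]
  have h : a ∈ ⨅ n, maximalIdeal A ^ n := by
    refine Submodule.mem_iInf _ |>.2 fun n => ?_
    have h1 : Ideal.span {x ^ (n + 1)} ≤ maximalIdeal A ^ n :=
      (Ideal.span_singleton_le_iff_mem _).2
        (Ideal.pow_le_pow_right n.le_succ (Ideal.pow_mem_pow hxm (n + 1)))
    exact h1 (hmem n)
  rwa [Ideal.iInf_pow_eq_bot_of_isLocalRing _ (maximalIdeal.isMaximal A).ne_top] at h

end CanonicalModule

/-! ### The implications between the four conditions. -/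

section Equivalences

open IsLocalRing
open scoped Pointwise

theorem isWeaklyAlmostGorenstein_of_maximalIdeal_smul_top_le {A : Type u} [CommRing A]
    [hloc : IsLocalRing A] (hCM : IsCohenMacaulayLocalRing A) (hdim : ringKrullDim A ≤ 1)
    {ω : Type u} [AddCommGroup ω] [Module A ω] (hω : IsCanonicalModule A ω) {w : ω}
    (hw : maximalIdeal A • (⊤ : Submodule A ω) ≤ Submodule.span A {w}) :
    IsWeaklyAlmostGorenstein A := by
  have := hω.maximalCohenMacaulay.finite
  exact ⟨hloc, hCM, hdim, ω, _, _, hω, exists_exact_of_maximalIdeal_smul_top_le hw⟩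

theorem IsWeaklyAlmostGorenstein.exists_maximalIdeal_smul_top_le {A : Type u} [CommRing A]
    [IsLocalRing A] (h : IsWeaklyAlmostGorenstein A) :
    ∃ (ω : Type u) (_ : AddCommGroup ω) (_ : Module A ω), IsCanonicalModule A ω ∧
      ∃ w : ω, maximalIdeal A • (⊤ : Submodule A ω) ≤ Submodule.span A {w} := by
  obtain ⟨_, -, -, ω, i1, i2, hω, n, f, g, hfg, -⟩ := h
  exact ⟨ω, i1, i2, hω, f 1, maximalIdeal_smul_top_le_of_exact hfg⟩

theorem mk_mem_maximalIdeal_iff {R : Type u} [CommRing R] [IsLocalRing R] {I : Ideal R}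
    [IsLocalRing (R ⧸ I)] {r : R} :
    Ideal.Quotient.mk I r ∈ maximalIdeal (R ⧸ I) ↔ r ∈ maximalIdeal R := by
  have hl : IsLocalHom (Ideal.Quotient.mk I) := .of_surjective _ Ideal.Quotient.mk_surjective
  exact not_congr (isUnit_map_iff (Ideal.Quotient.mk I) r)

variable {R : Type u} [CommRing R] [IsLocalRing R]

theorem IsAlmostGorenstein.isWeaklyAlmostGorenstein (hCM : IsCohenMacaulayLocalRing R)
    (hdim : ringKrullDim R = 1) (h : IsAlmostGorenstein R) : IsWeaklyAlmostGorenstein R := by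
  obtain ⟨_, -, ω, _, _, hω, C, _, _, f, g, hf, hfg, hg, hmult⟩ := h
  have := hCM.noetherian
  have := hω.maximalCohenMacaulay.finite
  have hCfin : Module.Finite R C := Module.Finite.of_surjective g hg
  obtain ⟨x, hxm, hx⟩ := hCM.maximalCohenMacaulay.exists_isSMulRegular hdim
  have hr (N : Type u) [AddCommGroup N] [Module R N] :
      LinearMap.range (LinearMap.lsmul R N x) = x • (⊤ : Submodule R N) := by
    ext z
    simp [Submodule.mem_smul_pointwise_iff_exists]
  obtain ⟨n, hn⟩ := exists_pow_smul_eq_zero_of_length_le hdim hxm hx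
    (hω.maximalCohenMacaulay.isSMulRegular hdim hxm hx) (by
      rw [hr, hr, ← Submodule.ideal_span_singleton_smul x (⊤ : Submodule R R), smul_eq_mul,
        Ideal.mul_top]
      exact hω.length_quotSMulTop_le hdim hxm hx) hf hfg hg
  have hxm' : x ^ (n + 1) ∈ maximalIdeal R := Ideal.pow_mem_of_mem _ hxm _ n.succ_pos
  have hx' : IsSMulRegular R (x ^ (n + 1)) := hx.pow _
  rw [hasMultiplicity_iff_of_pow_smul_eq_zero hdim hxm' hx' hn, Nat.cast_inj] at hmult
  have hart := isArtinianRing_quotient_span_singleton hdim hxm' hx'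
  have hfl : IsFiniteLength R C := isFiniteLength_of_smul_eq_zero hn
  obtain ⟨_, _⟩ := isFiniteLength_iff_isNoetherian_isArtinian.1 hfl
  have hlen : Module.length R (C ⧸ maximalIdeal R • (⊤ : Submodule R C)) = Module.length R C := by
    rw [← minGenerators_eq_length, hmult, ENat.natCast_toNat Module.length_ne_top]
  -- A proper quotient of a finite length module is strictly shorter, so `μ(C) = length C` leaves
  -- only `𝔪C = 0`.
  have hbot : maximalIdeal R • (⊤ : Submodule R C) = ⊥ := by
    by_contra hne
    exact (Submodule.length_quotient_lt _ hne).ne hlen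
  refine isWeaklyAlmostGorenstein_of_maximalIdeal_smul_top_le hCM hdim.le hω (w := f 1) ?_
  rw [Submodule.smul_le]
  intro a ha z _
  have h0 : g (a • z) = 0 := by
    rw [map_smul, ← Submodule.mem_bot R, ← hbot]
    exact Submodule.smul_mem_smul ha trivial
  obtain ⟨r, hr⟩ := (hfg _).1 h0
  rw [← hr]
  exact Submodule.mem_span_singleton.2 ⟨r, by rw [← map_smul, smul_eq_mul, mul_one]⟩

theorem IsWeaklyAlmostGorenstein.isAlmostGorenstein (hCM : IsCohenMacaulayLocalRing R)
    (hdim : ringKrullDim R = 1) (h : IsWeaklyAlmostGorenstein R) : IsAlmostGorenstein R := by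
  obtain ⟨ω, _, _, hω, w, hw⟩ := h.exists_maximalIdeal_smul_top_le
  have := hCM.noetherian
  have := hω.maximalCohenMacaulay.finite
  obtain ⟨x, hxm, hx⟩ := hCM.maximalCohenMacaulay.exists_isSMulRegular hdim
  have hxω := hω.maximalCohenMacaulay.isSMulRegular hdim hxm hx
  have hC {a : R} (ha : a ∈ maximalIdeal R) (c : ω ⧸ Submodule.span R {w}) : a • c = 0 := by
    obtain ⟨z, rfl⟩ := Submodule.mkQ_surjective _ c
    rw [← map_smul]
    exact (Submodule.Quotient.mk_eq_zero _).2 (hw (Submodule.smul_mem_smul ha trivial))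
  refine ⟨inferInstance, hCM, ω, _, _, hω, ω ⧸ Submodule.span R {w}, _, _,
    LinearMap.toSpanSingleton R ω w, (Submodule.span R {w}).mkQ, ?_, ?_,
    Submodule.mkQ_surjective _, ?_⟩
  -- If `aw = 0`, then `x a ω ⊆ a R w = 0`, since `xω ⊆ Rw`; cancelling `x` gives `aω = 0`, and `ω`
  -- is faithful.
  · refine (injective_iff_map_eq_zero _).2 fun a ha => ?_
    refine hω.eq_zero_of_smul_eq_zero hdim hxm hx fun z => hxω ?_
    obtain ⟨b, hb⟩ := Submodule.mem_span_singleton.1 (hw (Submodule.smul_mem_smul hxm (n := z) trivial))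
    change x • a • z = x • 0
    rw [smul_comm, ← hb, smul_comm, smul_zero]
    change a • w = 0 at ha
    rw [ha, smul_zero]
  · rw [LinearMap.exact_iff, Submodule.ker_mkQ, LinearMap.range_toSpanSingleton]
  · have hbot : maximalIdeal R • (⊤ : Submodule R (ω ⧸ Submodule.span R {w})) = ⊥ := by
      rw [eq_bot_iff, Submodule.smul_le]
      exact fun a ha c _ => (Submodule.mem_bot R).2 (hC ha c)
    rw [hasMultiplicity_iff_of_pow_smul_eq_zero hdim hxm hx (hC hxm), Nat.cast_inj]
    rw [← (Submodule.quotEquivOfEqBot _ hbot).length_eq, ← minGenerators_eq_length, ENat.toNat_natCast]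

theorem IsWeaklyAlmostGorenstein.quotient_span_singleton (hCM : IsCohenMacaulayLocalRing R)
    (hdim : ringKrullDim R = 1) (h : IsWeaklyAlmostGorenstein R) {x : R}
    (hxm : x ∈ maximalIdeal R) (hx : IsSMulRegular R x) :
    IsWeaklyAlmostGorenstein (R ⧸ Ideal.span {x}) := by
  obtain ⟨ω, _, _, hω, w, hw⟩ := h.exists_maximalIdeal_smul_top_le
  have := hCM.noetherian
  have := isLocalRing_quotient_span_singleton hxm
  have h0 := ringKrullDim_quotient_span_singleton_eq_zero hdim hxm hx
  refine isWeaklyAlmostGorenstein_of_maximalIdeal_smul_top_le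
    ⟨inferInstance, isMaximalCohenMacaulay_of_ringKrullDim_eq_zero h0⟩ (h0.trans_le zero_le_one)
    (hω.quotSMulTop hdim hxm hx) (w := Submodule.mkQ _ w) ?_
  rw [Submodule.smul_le]
  intro a ha z _
  obtain ⟨a, rfl⟩ := Ideal.Quotient.mk_surjective a
  obtain ⟨z, rfl⟩ := Submodule.mkQ_surjective _ z
  obtain ⟨c, hc⟩ := Submodule.mem_span_singleton.1
    (hw (Submodule.smul_mem_smul (mk_mem_maximalIdeal_iff.1 ha) (n := z) trivial))
  refine Submodule.mem_span_singleton.2 ⟨Ideal.Quotient.mk _ c, ?_⟩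
  change Submodule.mkQ _ (c • w) = Submodule.mkQ _ (a • z)
  rw [hc]

theorem isWeaklyAlmostGorenstein_of_quotient_span_singleton (hCM : IsCohenMacaulayLocalRing R)
    (hcan : HasCanonicalModule R) (hdim : ringKrullDim R = 1) {x : R}
    (hxm2 : x ∈ maximalIdeal R ^ 2) (hx : IsSMulRegular R x)
    (h : IsWeaklyAlmostGorenstein (R ⧸ Ideal.span {x})) : IsWeaklyAlmostGorenstein R := by
  obtain ⟨ω, _, _, hω⟩ := hcan
  have := hCM.noetherian
  have hfin := hω.maximalCohenMacaulay.finite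
  have hxm : x ∈ maximalIdeal R := Ideal.pow_le_self two_ne_zero hxm2
  have hloc := isLocalRing_quotient_span_singleton hxm
  have h0 := ringKrullDim_quotient_span_singleton_eq_zero hdim hxm hx
  have hart := isArtinianRing_quotient_span_singleton hdim hxm hx
  obtain ⟨E, _, _, hE, v, hv⟩ := h.exists_maximalIdeal_smul_top_le
  have := hE.maximalCohenMacaulay.finite
  have hQ := hω.quotSMulTop hdim hxm hx
  have := hQ.maximalCohenMacaulay.finite
  obtain ⟨e⟩ := (hE.hasOneDimensionalSocle_of_ringKrullDim_eq_zero h0).nonempty_linearEquiv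
    (hE.baer_of_ringKrullDim_eq_zero h0) (hQ.hasOneDimensionalSocle_of_ringKrullDim_eq_zero h0)
    (hQ.baer_of_ringKrullDim_eq_zero h0)
  obtain ⟨w, hw⟩ := Submodule.mkQ_surjective _ (e v)
  refine isWeaklyAlmostGorenstein_of_maximalIdeal_smul_top_le hCM hdim.le hω (w := w) ?_
  -- Nakayama is applied to `𝔪ω`, not to `ω`: it suffices that `𝔪ω ⊆ Rw + 𝔪(𝔪ω)`, and `xω` lies in
  -- the last term because `x ∈ 𝔪^2`.
  refine Submodule.le_of_le_smul_of_le_jacobson_bot (I := maximalIdeal R)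
    (IsNoetherian.noetherian _) (maximalIdeal_le_jacobson _) ?_
  rw [Submodule.smul_le]
  intro a ha z _
  obtain ⟨c, hc⟩ := Submodule.mem_span_singleton.1 (hv (Submodule.smul_mem_smul
    (mk_mem_maximalIdeal_iff.2 ha) (n := e.symm (Submodule.mkQ _ z)) trivial))
  obtain ⟨c, rfl⟩ := Ideal.Quotient.mk_surjective c
  have hc' := congrArg e hc
  rw [map_smul, map_smul, e.apply_symm_apply, ← hw] at hc'
  change Submodule.mkQ _ (c • w) = Submodule.mkQ _ (a • z) at hc'
  obtain ⟨y, -, hy⟩ := (Submodule.mem_smul_pointwise_iff_exists _ _ _).1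
    ((Submodule.Quotient.eq _).1 (hc'.symm : Submodule.Quotient.mk _ = Submodule.Quotient.mk _))
  rw [show a • z = c • w + x • y by rw [hy]; abel]
  refine Submodule.add_mem_sup (Submodule.smul_mem _ _ (Submodule.mem_span_singleton_self w)) ?_
  rw [← Submodule.mul_smul, ← pow_two]
  exact Submodule.smul_mem_smul hxm2 trivial

end Equivalences

theorem theoremC (R : Type u) [CommRing R] [IsLocalRing R]
    (hCM : IsCohenMacaulayLocalRing R) (hω : HasCanonicalModule R) (hdim : ringKrullDim R = 1) :
    List.TFAE [
      IsAlmostGorenstein R,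
      IsWeaklyAlmostGorenstein R,
      ∀ x ∈ IsLocalRing.maximalIdeal R, IsSMulRegular R x →
        IsWeaklyAlmostGorenstein (R ⧸ Ideal.span {x}),
      ∃ x ∈ IsLocalRing.maximalIdeal R ^ 2, IsSMulRegular R x ∧
        IsWeaklyAlmostGorenstein (R ⧸ Ideal.span {x})] := by
  tfae_have 1 → 2 := fun h => h.isWeaklyAlmostGorenstein hCM hdim
  tfae_have 2 → 1 := fun h => h.isAlmostGorenstein hCM hdim
  tfae_have 2 → 3 := fun h x hxm hx => h.quotient_span_singleton hCM hdim hxm hx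
  tfae_have 3 → 4 := fun h => by
    obtain ⟨x, hxm, hx⟩ := hCM.maximalCohenMacaulay.exists_isSMulRegular hdim
    exact ⟨x ^ 2, Ideal.pow_mem_pow hxm 2, hx.pow 2,
      h _ (Ideal.pow_mem_of_mem _ hxm _ two_pos) (hx.pow 2)⟩
  tfae_have 4 → 2 := fun ⟨x, hxm, hx, h⟩ =>
    isWeaklyAlmostGorenstein_of_quotient_span_singleton hCM hω hdim hxm hx h
  tfae_finish
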